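/- For positive integers $a_1,\ldots,a_m$ put $$M_m(a_1,\ldots,a_m)=\begin{pmatrix} a_m & -1\\ 1 & 0\end{pmatrix}\begin{pmatrix} a_{m-1} & -1\\ 1 & 0\end{pmatrix}\cdots\begin{pmatrix} a_1 & -1\\ 1 & 0\end{pmatrix}.$$ A $\lambda$-quiddity of size $m$ is an $m$-tuple $(a_1,\ldots,a_m)$ of positive integers such that $M_m(a_1,\ldots,a_m)=\pm \mathrm{Id}$. For integers $n\ge 1$ and $k\ge 1$, let $V_{k,n}$ denote the number of $\lambda$-quiddities of size $n+2$ whose last component $a_{n+2}$ is equal to $k$. Let $n\ge 3$ be an integer. Then $$V_{n,n}=1,\qquad V_{n-1,n}=n-1,\qquad V_{n-2,n}=\frac{(n+1)(n-2)}{2},$$ and $V_{k,n}>0$ for every integer $k$ with $1\le k\le n$. -/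

import Mathlib

/-- The elementary matrix with rows `(a, -1)` and `(1, 0)`. -/
def elemMat (a : ℤ) : Matrix (Fin 2) (Fin 2) ℤ := !![a, -1; 1, 0]

/-- `M_m(a₁, …, a_m) = elemMat a_m * ⋯ * elemMat a₁`; the tuple is indexed from `0` in Lean, so
`a i` is the `(i+1)`-st component, and the factor of the last component stands on the left. -/
def contMat {m : ℕ} (a : Fin m → ℕ+) : Matrix (Fin 2) (Fin 2) ℤ :=
  (List.ofFn fun i => elemMat ((a i : ℕ) : ℤ)).reverse.prod

/-- The `m`-tuple `a` of positive integers solves the equation `M_m(a₁, …, a_m) = ± M`. -/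
def IsSolutionOf (M : Matrix (Fin 2) (Fin 2) ℤ) {m : ℕ} (a : Fin m → ℕ+) : Prop :=
  contMat a = M ∨ contMat a = -M

/-- A `λ`-quiddity of size `m` (over the positive integers): `M_m(a₁, …, a_m) = ± Id`. -/
def IsLambdaQuiddity {m : ℕ} (a : Fin m → ℕ+) : Prop :=
  IsSolutionOf 1 a

/-- The `λ`-quiddities of size `n + 2` whose last component equals `k`. -/
def quidditiesWithLast (k n : ℕ) : Set (Fin (n + 2) → ℕ+) :=
  {a | IsLambdaQuiddity a ∧ ((a (Fin.last (n + 1)) : ℕ+) : ℕ) = k}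

/-- `V_{k,n}`: the number of `λ`-quiddities of size `n + 2` whose last component equals `k`. -/
noncomputable def quiddityCount (k n : ℕ) : ℕ :=
  (quidditiesWithLast k n).ncard

/-! A quiddity with last letter c is a positive word w with `ClosedBy c w`. If all letters of w were
at least 2, its matrix would have a positive upper left entry, where `elemInv c` has 0; so w
contains a 1, and its first 1 can be removed.

Write the length as c + d + 1. Clipping a leading 1 lowers c and the length together and keeps d;
clipping a 1 between two letters of w that exceed 1 lowers d by one. If the 1 is followed by another
1, three letters can be contracted without lowering c, which forces d ≥ 3 unless w = [1, 1]. So for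
d ≤ 2 only ears are clipped, and w comes from a triangulation with c triangles at the marked vertex
(`ClosedBy.le_or_mem_fanWords`). Removing the first of them gives the recursion `fanWords`, with
counts 1, c and c(c + 3)/2 for d = 0, 1, 2.

For positivity, insert letters 1 repeatedly into the word with d = 0. -/

/-- The product `elemMat aₘ * ⋯ * elemMat a₁` of a word of natural numbers. -/
def wordMat : List ℕ → Matrix (Fin 2) (Fin 2) ℤ
  | [] => 1
  | a :: w => wordMat w * elemMat a

/-- The inverse of `elemMat c`. -/
def elemInv (c : ℤ) : Matrix (Fin 2) (Fin 2) ℤ := !![0, 1; -1, c]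

/-- The word `w` followed by the letter `c` solves the equation `M = ± Id`. -/
def ClosedBy (c : ℤ) (w : List ℕ) : Prop :=
  wordMat w = elemInv c ∨ wordMat w = -elemInv c

/-- Add `k` to the first letter of a word. -/
def addHead (k : ℕ) : List ℕ → List ℕ
  | [] => []
  | h :: t => (h + k) :: t

/-- The words of length `c + d + 1`, `d ≤ 2`, closed by the letter `c`. They are the quiddities of
the triangulations of a polygon with `c` triangles at a marked vertex, listed according to the part
cut off by the first of these triangles. -/
def fanWords : ℕ → ℕ → Finset (List ℕ)
  | 0, 0 => {[0]}
  | 0, _ + 1 => ∅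
  | c + 1, 0 => (fanWords c 0).image fun w => 1 :: addHead 1 w
  | c + 1, 1 => (fanWords c 1).image (fun w => 1 :: addHead 1 w) ∪
      (fanWords c 0).image fun w => 2 :: 1 :: addHead 2 w
  | c + 1, 2 => (fanWords c 2).image (fun w => 1 :: addHead 1 w) ∪
      ((fanWords c 1).image (fun w => 2 :: 1 :: addHead 2 w) ∪
      ((fanWords c 0).image (fun w => 2 :: 2 :: 1 :: addHead 3 w) ∪
      (fanWords c 0).image fun w => 3 :: 1 :: 2 :: addHead 2 w))
  | _ + 1, _ + 3 => ∅

/-! ### Removing letters by matrix identities -/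

lemma wordMat_append (u v : List ℕ) : wordMat (u ++ v) = wordMat v * wordMat u := by
  induction u with
  | nil => simp [wordMat]
  | cons a u ih => simp [wordMat, ih, Matrix.mul_assoc]

lemma elemMat_mul_elemInv (c : ℤ) : elemMat c * elemInv c = 1 := by
  ext i j; fin_cases i <;> fin_cases j <;> simp [elemMat, elemInv]

lemma elemInv_mul_elemMat (c : ℤ) : elemInv c * elemMat c = 1 := by
  ext i j; fin_cases i <;> fin_cases j <;> simp [elemMat, elemInv]

lemma closedBy_iff (c : ℤ) (w : List ℕ) :
    ClosedBy c w ↔ elemMat c * wordMat w = 1 ∨ elemMat c * wordMat w = -1 := by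
  have key : ∀ X Y : Matrix (Fin 2) (Fin 2) ℤ, X = elemInv c * Y ↔ elemMat c * X = Y := by
    intro X Y
    constructor
    · rintro rfl; rw [← Matrix.mul_assoc, elemMat_mul_elemInv, Matrix.one_mul]
    · rintro rfl; rw [← Matrix.mul_assoc, elemInv_mul_elemMat, Matrix.one_mul]
  rw [ClosedBy, ← key, ← key]; simp

/-- Inserting a `1` between two neighbours, each increased by one, keeps the product. -/
lemma wordMat_insert (u v : List ℕ) (a b : ℕ) :
    wordMat (u ++ (a + 1) :: 1 :: (b + 1) :: v) = wordMat (u ++ a :: b :: v) := by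
  have h : elemMat ((b : ℤ) + 1) * elemMat 1 * elemMat ((a : ℤ) + 1) = elemMat b * elemMat a := by
    ext i j; fin_cases i <;> fin_cases j <;> simp [elemMat]; ring
  simp only [wordMat_append, wordMat]
  push_cast
  rw [Matrix.mul_assoc (wordMat v), Matrix.mul_assoc (wordMat v), h]
  simp [Matrix.mul_assoc]

lemma wordMat_contract (u v : List ℕ) (a b : ℕ) :
    wordMat (u ++ (a + 1) :: 1 :: 1 :: (b + 1) :: v) = -wordMat (u ++ (a + b + 1) :: v) := by
  have h : elemMat ((b : ℤ) + 1) * elemMat 1 * elemMat 1 * elemMat ((a : ℤ) + 1) =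
      -elemMat ((a : ℤ) + b + 1) := by
    ext i j; fin_cases i <;> fin_cases j <;> simp [elemMat]; ring
  simp only [wordMat_append, wordMat]
  push_cast
  rw [Matrix.mul_assoc (wordMat v), Matrix.mul_assoc (wordMat v), Matrix.mul_assoc (wordMat v), h]
  simp

lemma wordMat_one_cons (h : ℕ) (t : List ℕ) :
    wordMat (1 :: (h + 1) :: t) = wordMat (h :: t) * !![1, -1; 0, 1] := by
  have e : elemMat ((h : ℤ) + 1) * elemMat 1 = elemMat h * !![1, -1; 0, 1] := by
    ext i j; fin_cases i <;> fin_cases j <;> simp [elemMat]; ring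
  simp only [wordMat]
  push_cast
  rw [Matrix.mul_assoc, e, Matrix.mul_assoc]

/-- The cyclic case of clipping an ear, with the closing letter as one neighbour: both sides change
by the same invertible right factor. -/
lemma closedBy_one_cons (c : ℤ) (h : ℕ) (t : List ℕ) :
    ClosedBy (c + 1) (1 :: (h + 1) :: t) ↔ ClosedBy c (h :: t) := by
  have e : elemInv (c + 1) = elemInv c * !![1, -1; 0, 1] := by
    ext i j; fin_cases i <;> fin_cases j <;> simp [elemInv]; ring
  have f : (!![1, -1; 0, 1] : Matrix (Fin 2) (Fin 2) ℤ) * !![1, 1; 0, 1] = 1 := by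
    ext i j; fin_cases i <;> fin_cases j <;> simp
  have inj : ∀ X Y : Matrix (Fin 2) (Fin 2) ℤ,
      X * !![1, -1; 0, 1] = Y * !![1, -1; 0, 1] ↔ X = Y := by
    intro X Y
    refine ⟨fun hXY => ?_, fun hXY => by rw [hXY]⟩
    have := congrArg (· * (!![1, 1; 0, 1] : Matrix (Fin 2) (Fin 2) ℤ)) hXY
    simpa only [Matrix.mul_assoc, f, Matrix.mul_one] using this
  rw [ClosedBy, ClosedBy, wordMat_one_cons, e, ← Matrix.neg_mul, inj, inj]

lemma closedBy_insert {c : ℤ} {u v : List ℕ} {a b : ℕ} :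
    ClosedBy c (u ++ (a + 1) :: 1 :: (b + 1) :: v) ↔ ClosedBy c (u ++ a :: b :: v) := by
  rw [ClosedBy, ClosedBy, wordMat_insert]

lemma closedBy_contract {c : ℤ} {u v : List ℕ} {a b : ℕ} :
    ClosedBy c (u ++ (a + 1) :: 1 :: 1 :: (b + 1) :: v) ↔ ClosedBy c (u ++ (a + b + 1) :: v) := by
  rw [ClosedBy, ClosedBy, wordMat_contract, neg_inj, neg_eq_iff_eq_neg, or_comm]

/-- The cyclic form of `closedBy_contract`: the neighbours of the pair 1, 1 are c and b + 1, which
merge into the closing letter c + b. -/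
lemma ClosedBy.contract_head {c : ℤ} {b : ℕ} {v : List ℕ}
    (h : ClosedBy c (1 :: 1 :: (b + 1) :: v)) : ClosedBy (c + b) v := by
  have e : elemMat ((b : ℤ) + 1) * elemMat 1 * elemMat 1 * !![1, -(b : ℤ); 0, 1] = -1 := by
    ext i j; fin_cases i <;> fin_cases j <;> simp [elemMat]
  have f : elemInv c * !![1, -(b : ℤ); 0, 1] = elemInv (c + b) := by
    ext i j; fin_cases i <;> fin_cases j <;> simp [elemInv]; ring
  have g : wordMat (1 :: 1 :: (b + 1) :: v) * !![1, -(b : ℤ); 0, 1] = -wordMat v := by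
    simp only [wordMat]
    push_cast
    rw [Matrix.mul_assoc (wordMat v), Matrix.mul_assoc (wordMat v), Matrix.mul_assoc (wordMat v), e]
    simp
  rcases h with h | h <;> rw [h] at g
  · right; rw [← f, g, neg_neg]
  · left; rw [Matrix.neg_mul, neg_inj, f] at g; exact g.symm

lemma ClosedBy.contract_last {c : ℤ} {a : ℕ} {u : List ℕ}
    (h : ClosedBy c (u ++ [a + 1, 1, 1])) : ClosedBy (c + a) u := by
  have e : !![1, 0; (a : ℤ), 1] * (elemMat 1 * (elemMat 1 * elemMat ((a : ℤ) + 1))) = -1 := by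
    ext i j; fin_cases i <;> fin_cases j <;> simp [elemMat]
  have f : !![1, 0; (a : ℤ), 1] * elemInv c = elemInv (c + a) := by
    ext i j; fin_cases i <;> fin_cases j <;> simp [elemInv]; ring
  have g : !![1, 0; (a : ℤ), 1] * wordMat (u ++ [a + 1, 1, 1]) = -wordMat u := by
    rw [wordMat_append]
    simp only [wordMat]
    push_cast
    rw [Matrix.one_mul, Matrix.mul_assoc (elemMat 1), ← Matrix.mul_assoc _ _ (wordMat u), e]
    simp
  rcases h with h | h <;> rw [h] at g
  · right; rw [← f, g, neg_neg]
  · left; rw [Matrix.mul_neg, neg_inj, f] at g; exact g.symm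

/-! ### Locating the first 1 -/

/-- A further letter x sends the first column (p, q) to (xp - q, p), and xp - q > p when x ≥ 2 and p
> q ≥ 0. -/
lemma wordMat_column_pos (u : List ℕ) (hu : ∀ x ∈ u, 2 ≤ x) :
    0 ≤ wordMat u 1 0 ∧ wordMat u 1 0 < wordMat u 0 0 := by
  induction u using List.reverseRecOn with
  | nil => simp [wordMat]
  | append_singleton u x ih =>
    obtain ⟨h0, h1⟩ := ih fun y hy => hu y (by simp [hy])
    have hx : (2 : ℤ) ≤ x := by exact_mod_cast hu x (by simp)
    have e0 : wordMat (u ++ [x]) 0 0 = x * wordMat u 0 0 - wordMat u 1 0 := by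
      simp [wordMat_append, wordMat, elemMat, Matrix.mul_apply, Fin.sum_univ_two]; ring
    have e1 : wordMat (u ++ [x]) 1 0 = wordMat u 0 0 := by
      simp [wordMat_append, wordMat, elemMat, Matrix.mul_apply, Fin.sum_univ_two]
    rw [e0, e1]
    constructor
    · linarith
    · nlinarith

lemma ClosedBy.entry_eq_zero {c : ℤ} {w : List ℕ} (h : ClosedBy c w) : wordMat w 0 0 = 0 := by
  rcases h with h | h <;> simp [h, elemInv]

lemma not_closedBy_of_two_le {c : ℤ} {u : List ℕ} (hu : ∀ x ∈ u, 2 ≤ x) : ¬ ClosedBy c u := by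
  intro h
  have := wordMat_column_pos u hu
  have := h.entry_eq_zero
  omega

lemma not_closedBy_append_one {c : ℤ} {u : List ℕ} (hu : ∀ x ∈ u, 2 ≤ x) :
    ¬ ClosedBy c (u ++ [1]) := by
  intro h
  have h1 := wordMat_column_pos u hu
  have h2 := h.entry_eq_zero
  have e0 : wordMat (u ++ [1]) 0 0 = wordMat u 0 0 - wordMat u 1 0 := by
    simp [wordMat_append, wordMat, elemMat, Matrix.mul_apply, Fin.sum_univ_two]; ring
  omega

lemma exists_first_one (w : List ℕ) (hw : ∀ x ∈ w, 0 < x) :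
    (∀ x ∈ w, 2 ≤ x) ∨ ∃ u v, w = u ++ 1 :: v ∧ ∀ x ∈ u, 2 ≤ x := by
  induction w with
  | nil => simp
  | cons a w ih =>
    have ha := hw a (by simp)
    by_cases h1 : a = 1
    · exact Or.inr ⟨[], w, by simp [h1], by simp⟩
    · rcases ih fun x hx => hw x (by simp [hx]) with h | ⟨u, v, rfl, h⟩
      · left
        intro x hx
        rcases List.mem_cons.1 hx with rfl | hx
        · omega
        · exact h x hx
      · right
        refine ⟨a :: u, v, by simp, ?_⟩
        intro x hx
        rcases List.mem_cons.1 hx with rfl | hx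
        · omega
        · exact h x hx

/-! ### The listed words: stability, completeness, soundness -/

lemma addHead_injective (k : ℕ) : Function.Injective (addHead k) := by
  intro u v h
  cases u <;> cases v <;> simp_all [addHead]

lemma append_eq_addHead {k a b : ℕ} {u v w : List ℕ} (h : u ++ a :: b :: v = addHead k w) :
    ∃ u' a', w = u' ++ a' :: b :: v ∧
      u ++ (a + 1) :: 1 :: (b + 1) :: v = addHead k (u' ++ (a' + 1) :: 1 :: (b + 1) :: v) := by
  cases w with
  | nil => simp [addHead] at h
  | cons x t =>
    cases u with
    | nil =>
      simp only [addHead, List.nil_append, List.cons.injEq] at h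
      obtain ⟨rfl, rfl⟩ := h
      exact ⟨[], x, by simp, by simp [addHead]; omega⟩
    | cons y u =>
      simp only [addHead, List.cons_append, List.cons.injEq] at h
      obtain ⟨rfl, rfl⟩ := h
      exact ⟨x :: u, a, by simp, by simp [addHead]⟩

/-- An ear is glued either to the part cut off by the first triangle or to the remaining polygon,
where induction on c applies. -/
lemma insert_mem_fanWords (c : ℕ) : ∀ (d : ℕ) (u v : List ℕ) (a b : ℕ), d ≤ 1 →
    u ++ a :: b :: v ∈ fanWords c d →
    u ++ (a + 1) :: 1 :: (b + 1) :: v ∈ fanWords c (d + 1) := by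
  induction c with
  | zero =>
    intro d u v a b hd h
    rcases d with _ | d
    · have := congrArg List.length (Finset.mem_singleton.1 (by simpa only [fanWords] using h))
      simp at this
      omega
    · simp [fanWords] at h
  | succ c ih =>
    have stepA : ∀ (u v : List ℕ) (a b : ℕ) (w : List ℕ), 1 :: addHead 1 w = u ++ a :: b :: v →
        (u ++ (a + 1) :: 1 :: (b + 1) :: v = 2 :: 1 :: addHead 2 w) ∨
        ∃ u' a', w = u' ++ a' :: b :: v ∧ 1 :: addHead 1 (u' ++ (a' + 1) :: 1 :: (b + 1) :: v) =
          u ++ (a + 1) :: 1 :: (b + 1) :: v := by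
      intro u v a b w h
      cases u with
      | nil =>
        left
        cases w <;> simp_all [addHead]
        omega
      | cons x u =>
        right
        simp only [List.cons_append, List.cons.injEq] at h
        obtain ⟨rfl, h⟩ := h
        obtain ⟨u', a', hw, h'⟩ := append_eq_addHead h.symm
        exact ⟨u', a', hw, by simp [h']⟩
    intro d u v a b hd h
    rcases d with _ | _ | d
    · simp only [fanWords, Finset.mem_image] at h
      obtain ⟨w, hw, h⟩ := h
      simp only [fanWords, Finset.mem_union, Finset.mem_image]
      rcases stepA u v a b w h with h' | ⟨u', a', rfl, h'⟩
      · exact Or.inr ⟨w, hw, h'.symm⟩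
      · exact Or.inl ⟨_, ih 0 _ _ _ _ (by omega) hw, h'⟩
    · simp only [fanWords, Finset.mem_union, Finset.mem_image] at h
      simp only [fanWords, Finset.mem_union, Finset.mem_image]
      rcases h with ⟨w, hw, h⟩ | ⟨w, hw, h⟩
      · rcases stepA u v a b w h with h' | ⟨u', a', rfl, h'⟩
        · exact Or.inr (Or.inl ⟨w, hw, h'.symm⟩)
        · exact Or.inl ⟨_, ih 1 _ _ _ _ le_rfl hw, h'⟩
      -- The cut-off part is one triangle with two outer edges; an ear on either gives one of the
      -- two triangulated quadrilaterals.
      · rcases u with _ | ⟨x, _ | ⟨y, u⟩⟩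
        · refine Or.inr (Or.inr (Or.inr ⟨w, hw, ?_⟩))
          simp only [List.nil_append, List.cons.injEq] at h ⊢
          obtain ⟨rfl, rfl, rfl⟩ := h
          simp
        · refine Or.inr (Or.inr (Or.inl ⟨w, hw, ?_⟩))
          cases w <;> simp_all [addHead]
          omega
        · simp only [List.cons_append, List.cons.injEq] at h
          obtain ⟨rfl, rfl, h⟩ := h
          obtain ⟨u', a', rfl, h'⟩ := append_eq_addHead h.symm
          exact Or.inr (Or.inl ⟨_, ih 0 _ _ _ _ (by omega) hw, by simp [h']⟩)
    · omega

lemma one_cons_mem_fanWords {c d : ℕ} {w : List ℕ} (hd : d ≤ 2) (h : w ∈ fanWords c d) :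
    1 :: addHead 1 w ∈ fanWords (c + 1) d := by
  rcases d with _ | _ | _ | d
  · exact Finset.mem_image_of_mem _ h
  · exact Finset.mem_union_left _ (Finset.mem_image_of_mem _ h)
  · exact Finset.mem_union_left _ (Finset.mem_image_of_mem _ h)
  · omega

/-- A word closed by a letter `c` within two of the maximal value is one of the listed words. -/
theorem ClosedBy.le_or_mem_fanWords (L : ℕ) : ∀ (c : ℤ) (w : List ℕ), w.length = L →
    (∀ x ∈ w, 0 < x) → ClosedBy c w →
    c + 4 ≤ L ∨ ∃ k d : ℕ, c = k ∧ d ≤ 2 ∧ L = k + d + 1 ∧ w ∈ fanWords k d := by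
  induction L using Nat.strong_induction_on with
  | _ L ih =>
  have bound : ∀ (c : ℤ) (w : List ℕ), w.length < L → (∀ x ∈ w, 0 < x) → ClosedBy c w →
      c + 1 ≤ w.length := by
    intro c w hl hw h
    rcases ih _ hl c w rfl hw h with h | ⟨k, d, rfl, -, h, -⟩ <;> omega
  intro c w hL hw h
  rcases exists_first_one w hw with h2 | ⟨u, v, rfl, h2⟩
  · exact absurd h (not_closedBy_of_two_le h2)
  rcases List.eq_nil_or_concat u with rfl | ⟨u, a, rfl⟩
  · rcases v with _ | ⟨x, v⟩
    · exact absurd h (not_closedBy_append_one (u := []) (by simp))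
    simp only [List.nil_append, List.length_cons, List.mem_cons, forall_eq_or_imp] at h hL hw
    obtain ⟨-, hx, hv⟩ := hw
    obtain ⟨x, rfl⟩ : ∃ y, x = y + 1 := ⟨x - 1, by omega⟩
    rcases Nat.eq_zero_or_pos x with rfl | hx
    · rcases v with _ | ⟨b, v⟩
      · have hc : c = 1 := by
          rcases h with h | h <;> have := congrFun (congrFun h 1) 1 <;>
            have h' := congrFun (congrFun h 0) 1 <;>
            simp [wordMat, elemMat, elemInv] at this h' <;> omega
        exact Or.inr ⟨1, 0, by simp [hc], by simp, by simpa using hL.symm, by decide⟩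
      · simp only [List.length_cons, List.mem_cons, forall_eq_or_imp] at hL hv
        obtain ⟨b, rfl⟩ : ∃ y, b = y + 1 := ⟨b - 1, by omega⟩
        have := bound _ v (by omega) hv.2 h.contract_head
        omega
    -- Clipping the leading 1 keeps d. The new c is not known to be positive, hence c ranges over
    -- the integers.
    · obtain ⟨c, rfl⟩ : ∃ e, c = e + 1 := ⟨c - 1, by omega⟩
      rw [closedBy_one_cons] at h
      rcases ih (L - 1) (by omega) c (x :: v) (by simp; omega) (by simpa using ⟨hx, hv⟩) h with
        h | ⟨k, d, rfl, hd, hk, h⟩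
      · left; omega
      · exact Or.inr ⟨k + 1, d, by simp, hd, by omega, one_cons_mem_fanWords hd h⟩
  · rcases v with _ | ⟨b, v⟩
    · exact absurd h (not_closedBy_append_one h2)
    have hu : ∀ x ∈ u, 0 < x := fun x hx => hw x (by simp [hx])
    have hv : ∀ x ∈ v, 0 < x := fun x hx => hw x (by simp [hx])
    have ha : 2 ≤ a := h2 a (by simp)
    have hb : 0 < b := hw b (by simp)
    simp only [List.concat_eq_append, List.append_assoc, List.singleton_append,
      List.length_append, List.length_cons] at h hL ⊢
    obtain ⟨a, rfl⟩ : ∃ y, a = y + 1 := ⟨a - 1, by omega⟩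
    obtain ⟨b, rfl⟩ : ∃ y, b = y + 1 := ⟨b - 1, by omega⟩
    -- For a pair 1, 1, contraction leaves L - 3 letters closed by at least c, so `bound` gives c +
    -- 4 ≤ L.
    rcases Nat.eq_zero_or_pos b with rfl | hb
    · left
      rcases v with _ | ⟨y, v⟩
      · have := bound _ u (by simp at hL; omega) hu h.contract_last
        simp at hL
        omega
      · have hy : 0 < y := hv y (by simp)
        obtain ⟨y, rfl⟩ : ∃ z, y = z + 1 := ⟨y - 1, by omega⟩
        have := bound _ (u ++ (a + y + 1) :: v) (by simp at hL ⊢; omega) (by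
          intro x hx
          simp only [List.mem_append, List.mem_cons] at hx
          rcases hx with hx | rfl | hx
          · exact hu x hx
          · omega
          · exact hv x (by simp [hx])) (closedBy_contract.1 h)
        simp at hL this
        omega
    -- Clipping an inner ear fixes c and shortens the word, so d for w is one larger; from d = 2 it
    -- reaches c + 4 ≤ L.
    · rcases ih (L - 1) (by omega) c (u ++ a :: b :: v) (by simp; omega) (by
          intro x hx
          simp only [List.mem_append, List.mem_cons] at hx
          rcases hx with hx | rfl | rfl | hx
          · exact hu x hx
          · omega
          · omega
          · exact hv x hx) (closedBy_insert.1 h) with h' | ⟨k, d, rfl, hd, hk, h'⟩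
      · left; omega
      · by_cases hd2 : d ≤ 1
        · exact Or.inr ⟨k, d + 1, rfl, by omega, by omega, insert_mem_fanWords k d u v a b hd2 h'⟩
        · left; omega

lemma ClosedBy.lt_length {c : ℤ} {w : List ℕ} (hw : ∀ x ∈ w, 0 < x) (h : ClosedBy c w) :
    c + 1 ≤ w.length := by
  rcases ClosedBy.le_or_mem_fanWords _ c w rfl hw h with h | ⟨k, d, rfl, -, h, -⟩ <;> omega

/-- The seed [0] has a zero head, so for c = 0 only the tail is positive; `addHead` repairs the head
at the next step. -/
lemma fanWords_sound (c : ℕ) : ∀ (d : ℕ), ∀ w ∈ fanWords c d,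
    w.length = c + d + 1 ∧ ClosedBy c w ∧ (∀ x ∈ w.tail, 0 < x) ∧ (0 < c → ∀ x ∈ w, 0 < x) := by
  induction c with
  | zero =>
    intro d w hw
    rcases d with _ | d
    · obtain rfl : w = [0] := Finset.mem_singleton.1 (by simpa only [fanWords] using hw)
      refine ⟨rfl, Or.inr ?_, by simp, by simp⟩
      ext i j; fin_cases i <;> fin_cases j <;> simp [wordMat, elemMat, elemInv]
    · simp [fanWords] at hw
  | succ c ih =>
    have stepA : ∀ d, ∀ w ∈ fanWords c d, ∃ h t, w = h :: t ∧ t.length = c + d ∧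
        ClosedBy (c + 1 : ℕ) (1 :: (h + 1) :: t) ∧ ∀ x ∈ t, 0 < x := by
      intro d w hw
      obtain ⟨hl, hc, ht, -⟩ := ih d w hw
      rcases w with _ | ⟨h, t⟩
      · simp at hl
      · refine ⟨h, t, rfl, by simpa using hl, ?_, by simpa using ht⟩
        push_cast
        rwa [closedBy_one_cons]
    have fin : ∀ (d : ℕ) (w : List ℕ), w.length = c + 1 + d + 1 → ClosedBy (c + 1 : ℕ) w →
        (∀ x ∈ w, 0 < x) → w.length = c + 1 + d + 1 ∧ ClosedBy (c + 1 : ℕ) w ∧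
          (∀ x ∈ w.tail, 0 < x) ∧ (0 < c + 1 → ∀ x ∈ w, 0 < x) :=
      fun d w h1 h2 h3 => ⟨h1, h2, fun x hx => h3 x (List.mem_of_mem_tail hx), fun _ => h3⟩
    have inA : ∀ d, ∀ w ∈ fanWords c d, (1 :: addHead 1 w).length = c + 1 + d + 1 ∧
        ClosedBy (c + 1 : ℕ) (1 :: addHead 1 w) ∧ ∀ x ∈ 1 :: addHead 1 w, 0 < x := by
      intro d w hw
      obtain ⟨h, t, rfl, hl, hc, ht⟩ := stepA d w hw
      exact ⟨by simp [addHead]; omega, hc, by simpa [addHead] using ht⟩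
    have inB : ∀ d, ∀ w ∈ fanWords c d, (2 :: 1 :: addHead 2 w).length = c + 1 + (d + 1) + 1 ∧
        ClosedBy (c + 1 : ℕ) (2 :: 1 :: addHead 2 w) ∧ ∀ x ∈ 2 :: 1 :: addHead 2 w, 0 < x := by
      intro d w hw
      obtain ⟨h, t, rfl, hl, hc, ht⟩ := stepA d w hw
      exact ⟨by simp [addHead]; omega, (closedBy_insert (u := []) (a := 1)).2 hc,
        by simpa [addHead] using ht⟩
    intro d w hw
    rcases d with _ | _ | _ | d
    · simp only [fanWords, Finset.mem_image] at hw
      obtain ⟨w, hw, rfl⟩ := hw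
      obtain ⟨h1, h2, h3⟩ := inA _ _ hw
      exact fin 0 _ h1 h2 h3
    · simp only [fanWords, Finset.mem_image, Finset.mem_union] at hw
      rcases hw with ⟨w, hw, rfl⟩ | ⟨w, hw, rfl⟩
      · obtain ⟨h1, h2, h3⟩ := inA _ _ hw
        exact fin 1 _ h1 h2 h3
      · obtain ⟨h1, h2, h3⟩ := inB _ _ hw
        exact fin 1 _ h1 h2 h3
    · simp only [fanWords, Finset.mem_image, Finset.mem_union] at hw
      rcases hw with ⟨w, hw, rfl⟩ | ⟨w, hw, rfl⟩ | ⟨w, hw, rfl⟩ | ⟨w, hw, rfl⟩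
      · obtain ⟨h1, h2, h3⟩ := inA _ _ hw
        exact fin 2 _ h1 h2 h3
      · obtain ⟨h1, h2, h3⟩ := inB _ _ hw
        exact fin 2 _ h1 h2 h3
      · obtain ⟨h1, h2, h3⟩ := inB _ _ hw
        obtain ⟨h, t, rfl, hl, -, ht⟩ := stepA _ _ hw
        exact fin 2 _ (by simp [addHead]; omega) ((closedBy_insert (u := [2]) (a := 1)).2 h2)
          (by simpa [addHead] using ht)
      · obtain ⟨h1, h2, h3⟩ := inB _ _ hw
        obtain ⟨h, t, rfl, hl, -, ht⟩ := stepA _ _ hw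
        exact fin 2 _ (by simp [addHead]; omega)
          ((closedBy_insert (u := []) (a := 2) (b := 1)).2 h2) (by simpa [addHead] using ht)
    · simp [fanWords] at hw

lemma mem_fanWords_iff {k d : ℕ} (hk : 0 < k) (hd : d ≤ 2) (w : List ℕ) :
    w ∈ fanWords k d ↔ w.length = k + d + 1 ∧ (∀ x ∈ w, 0 < x) ∧ ClosedBy k w := by
  constructor
  · intro h
    obtain ⟨h1, h2, -, h3⟩ := fanWords_sound k d w h
    exact ⟨h1, h3 hk, h2⟩
  · rintro ⟨h1, h2, h3⟩
    rcases ClosedBy.le_or_mem_fanWords _ k w rfl h2 h3 with h | ⟨k', d', hk', -, h, hw⟩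
    · omega
    · obtain rfl : k = k' := by exact_mod_cast hk'
      obtain rfl : d = d' := by omega
      exact hw

/-! ### Counting the listed words -/

lemma card_image_cons_addHead (p : List ℕ) (k : ℕ) (s : Finset (List ℕ)) :
    (s.image fun w => p ++ addHead k w).card = s.card :=
  Finset.card_image_of_injective _ fun _ _ h => addHead_injective k (List.append_cancel_left h)

lemma card_fanWords_zero (c : ℕ) : (fanWords c 0).card = 1 := by
  induction c with
  | zero => rfl
  | succ c ih => exact (card_image_cons_addHead [1] 1 _).trans ih

lemma card_fanWords_one (c : ℕ) : (fanWords c 1).card = c := by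
  induction c with
  | zero => rfl
  | succ c ih =>
    rw [fanWords, Finset.card_union_of_disjoint]
    · have h1 := card_image_cons_addHead [1] 1 (fanWords c 1)
      have h2 := card_image_cons_addHead [2, 1] 2 (fanWords c 0)
      rw [card_fanWords_zero] at h2
      simp only [List.cons_append, List.nil_append] at h1 h2
      omega
    · simp +contextual [Finset.disjoint_left]

lemma two_mul_card_fanWords_two (c : ℕ) : 2 * (fanWords c 2).card = c * (c + 3) := by
  induction c with
  | zero => rfl
  | succ c ih =>
    rw [fanWords, Finset.card_union_of_disjoint, Finset.card_union_of_disjoint,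
      Finset.card_union_of_disjoint]
    · have h1 := card_image_cons_addHead [1] 1 (fanWords c 2)
      have h2 := card_image_cons_addHead [2, 1] 2 (fanWords c 1)
      have h3 := card_image_cons_addHead [2, 2, 1] 3 (fanWords c 0)
      have h4 := card_image_cons_addHead [3, 1, 2] 2 (fanWords c 0)
      rw [card_fanWords_zero] at h3 h4
      rw [card_fanWords_one] at h2
      simp only [List.cons_append, List.nil_append] at h1 h2 h3 h4
      rw [h1, h2, h3, h4]
      linarith
    -- The families are told apart by their prefixes 1; 2, 1; 2, 2; and 3.
    all_goals
      rw [Finset.disjoint_left]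
      intro w h
      simp only [Finset.mem_image, Finset.mem_union] at h ⊢
      grind

/-! ### From tuples to words -/

/-- All components but the last of a tuple, as a word. -/
def initWord {n : ℕ} (a : Fin (n + 2) → ℕ+) : List ℕ :=
  List.ofFn fun i : Fin (n + 1) => (a i.castSucc : ℕ)

lemma wordMat_eq_prod (w : List ℕ) :
    wordMat w = (w.map fun x : ℕ => elemMat (x : ℤ)).reverse.prod := by
  induction w with
  | nil => simp [wordMat]
  | cons a w ih => simp [wordMat, ih]

lemma contMat_eq {n : ℕ} (a : Fin (n + 2) → ℕ+) :
    contMat a = elemMat ((a (Fin.last (n + 1)) : ℕ) : ℤ) * wordMat (initWord a) := by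
  rw [contMat, List.ofFn_succ', wordMat_eq_prod, initWord, List.map_ofFn]
  simp [Function.comp_def]

lemma isLambdaQuiddity_iff {n : ℕ} (a : Fin (n + 2) → ℕ+) :
    IsLambdaQuiddity a ↔ ClosedBy ((a (Fin.last (n + 1)) : ℕ) : ℤ) (initWord a) := by
  rw [closedBy_iff, ← contMat_eq]; rfl

lemma initWord_injOn (k n : ℕ) : Set.InjOn initWord (quidditiesWithLast k n) := by
  intro a ha b hb h
  funext i
  refine Fin.lastCases ?_ (fun i => ?_) i
  · exact PNat.coe_injective (ha.2.trans hb.2.symm)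
  · exact PNat.coe_injective (congrFun (List.ofFn_injective h) i)

lemma image_initWord {k n : ℕ} (hk : 0 < k) : initWord '' quidditiesWithLast k n =
    {w | w.length = n + 1 ∧ (∀ x ∈ w, 0 < x) ∧ ClosedBy k w} := by
  ext w
  constructor
  · rintro ⟨a, ⟨h, rfl⟩, rfl⟩
    exact ⟨by simp [initWord], by simp [initWord, List.mem_ofFn], (isLambdaQuiddity_iff a).1 h⟩
  · rintro ⟨hl, hp, hc⟩
    let f : Fin (n + 1) → ℕ+ := fun i => ⟨w[(i : ℕ)]'(by omega), hp _ (List.getElem_mem _)⟩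
    let a : Fin (n + 2) → ℕ+ := Fin.snoc (α := fun _ => ℕ+) f ⟨k, hk⟩
    have hlast : ((a (Fin.last (n + 1)) : ℕ+) : ℕ) = k :=
      congrArg PNat.val (Fin.snoc_last (α := fun _ => ℕ+) _ _)
    have hinit : initWord a = w := by
      apply List.ext_getElem
      · simp [initWord, hl]
      · intro i h1 h2
        simp only [initWord, List.getElem_ofFn]
        exact congrArg PNat.val (Fin.snoc_castSucc (α := fun _ => ℕ+) _ f ⟨i, by omega⟩)
    exact ⟨a, ⟨(isLambdaQuiddity_iff a).2 (by rw [hlast, hinit]; exact hc), hlast⟩, hinit⟩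

lemma quiddityCount_eq {k n : ℕ} (hk : 0 < k) : quiddityCount k n =
    {w | w.length = n + 1 ∧ (∀ x ∈ w, 0 < x) ∧ ClosedBy k w}.ncard := by
  rw [← image_initWord hk, (initWord_injOn k n).ncard_image, quiddityCount]

lemma quiddityCount_eq_card {k d : ℕ} (hk : 0 < k) (hd : d ≤ 2) :
    quiddityCount k (k + d) = (fanWords k d).card := by
  rw [quiddityCount_eq hk, ← Set.ncard_coe_finset]
  congr 1
  ext w
  exact (mem_fanWords_iff hk hd w).symm

/-! ### Finiteness and existence -/

/-- Rotating a closed word: each of its letters closes the word formed by the other letters. -/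
lemma ClosedBy.rotate {c a : ℕ} {u v : List ℕ} (h : ClosedBy c (u ++ a :: v)) :
    ClosedBy a (v ++ c :: u) := by
  rw [closedBy_iff] at h ⊢
  have key : ∀ X Y : Matrix (Fin 2) (Fin 2) ℤ, X * Y = 1 ∨ X * Y = -1 →
      Y * X = 1 ∨ Y * X = -1 := by
    rintro X Y (h | h)
    · exact Or.inl (mul_eq_one_comm.1 h)
    · right
      have : -X * Y = 1 := by rw [Matrix.neg_mul, h, neg_neg]
      rw [← neg_neg (Y * X), ← Matrix.mul_neg, mul_eq_one_comm.1 this]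
  have := key (elemMat c * wordMat v) (elemMat a * wordMat u) (by
    simpa [wordMat_append, wordMat, Matrix.mul_assoc] using h)
  simpa [wordMat_append, wordMat, Matrix.mul_assoc] using this

lemma finite_closed_words {k : ℕ} (hk : 0 < k) (L : ℕ) :
    {w : List ℕ | w.length = L ∧ (∀ x ∈ w, 0 < x) ∧ ClosedBy k w}.Finite := by
  refine (List.finite_length_eq (Fin (L + 1)) L |>.image (List.map Fin.val)).subset ?_
  rintro w ⟨hl, hp, hc⟩
  -- After rotation any letter is the closing one, so `ClosedBy.lt_length` bounds it.
  have hb : ∀ x ∈ w, x < L + 1 := by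
    intro x hx
    obtain ⟨u, v, rfl⟩ := List.append_of_mem hx
    have := hc.rotate.lt_length (by
      intro y hy
      simp only [List.mem_append, List.mem_cons] at hy
      rcases hy with hy | rfl | hy
      · exact hp y (by simp [hy])
      · exact hk
      · exact hp y (by simp [hy]))
    simp at hl this
    omega
  refine ⟨w.pmap (fun x hx => ⟨x, hx⟩) hb, by simp [hl], ?_⟩
  rw [List.map_pmap]
  simp

lemma exists_closed_word {k : ℕ} (hk : 0 < k) (d : ℕ) :
    ∃ a b t, (a :: b :: t).length = k + d + 1 ∧ (∀ x ∈ a :: b :: t, 0 < x) ∧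
      ClosedBy k (a :: b :: t) := by
  induction d with
  | zero =>
    obtain ⟨w, hw⟩ : (fanWords k 0).Nonempty := by
      rw [← Finset.card_pos, card_fanWords_zero]; exact one_pos
    obtain ⟨h1, h2, h3⟩ := (mem_fanWords_iff hk (by omega) w).1 hw
    rcases w with _ | ⟨a, _ | ⟨b, t⟩⟩
    · simp at h1
    · simp at h1; omega
    · exact ⟨a, b, t, h1, h2, h3⟩
  | succ d ih =>
    obtain ⟨a, b, t, h1, h2, h3⟩ := ih
    refine ⟨a + 1, 1, (b + 1) :: t, by simp at h1 ⊢; omega, ?_, (closedBy_insert (u := [])).2 h3⟩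
    simp only [List.mem_cons, forall_eq_or_imp] at h2 ⊢
    exact ⟨by omega, by omega, by omega, h2.2.2⟩

theorem proposition2p8 (n : ℕ) (hn : 3 ≤ n) :
    quiddityCount n n = 1 ∧
    quiddityCount (n - 1) n = n - 1 ∧
    (quiddityCount (n - 2) n : ℚ) = ((n : ℚ) + 1) * ((n : ℚ) - 2) / 2 ∧
    ∀ k : ℕ, 1 ≤ k → k ≤ n → 0 < quiddityCount k n := by
  obtain ⟨m, rfl⟩ : ∃ m, n = m + 2 := ⟨n - 2, by omega⟩
  refine ⟨?_, ?_, ?_, fun k hk hkn => ?_⟩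
  · exact (quiddityCount_eq_card (d := 0) (by omega) (by omega)).trans (card_fanWords_zero _)
  · exact (quiddityCount_eq_card (k := m + 1) (d := 1) (by omega) (by omega)).trans
      (card_fanWords_one _)
  · rw [Nat.add_sub_cancel, quiddityCount_eq_card (by omega) le_rfl]
    have h : (2 : ℚ) * (fanWords m 2).card = m * (m + 3) := by
      exact_mod_cast two_mul_card_fanWords_two m
    push_cast
    linarith
  · obtain ⟨d, hd⟩ := Nat.exists_eq_add_of_le hkn
    -- An infinite set has `ncard` 0, so finiteness is needed as well as a witness.
    rw [quiddityCount_eq hk, Set.ncard_pos (finite_closed_words hk _), hd]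
    obtain ⟨a, b, t, h⟩ := exists_closed_word hk d
    exact ⟨_, h⟩
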